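/- Let $d\ge 3$ and $n\ge 2$ be integers, and put $a=d-1$ and $q_k=1+a+\dots+a^{k-1}$ for $k\ge 1$. Let $T_n$ be the $d$-regular tree of height $n$, that is, the finite rooted tree in which each non-leaf vertex has $d-1$ children and the path from each leaf to the root has $n-1$ edges. The wired $d$-regular tree $\bar T_n$ of height $n$ is the multigraph obtained from $T_n$ by collapsing all the leaves to a single vertex $s$, the sink (keeping multiple edges), and adding an edge connecting the root to the sink. For a finite loopless multigraph $G$ with a chosen sink $s$ and set $V$ of non-sink vertices, let $\Delta$ be the reduced Laplacian, the $V\times V$ integer matrix whose diagonal entry $\Delta_{xx}$ is minus the degree of $x$ in $G$ and whose entry $\Delta_{xy}$ for $x\ne y$ is the number of edges connecting $x$ and $y$; the sandpile group of $G$ is the quotient $SP(G)=\mathbb Z^{V}/\Delta\mathbb Z^{V}$. Write $\mathbb Z_q^m$ for the direct sum of $m$ copies of $\mathbb Z/q\mathbb Z$. Then there is an isomorphism of abelian groups $$SP(\bar T_n)\;\cong\;\mathbb Z_{q_n}\oplus\bigoplus_{k=2}^{n-1}\mathbb Z_{q_k}^{\,a^{n-1-k}(a-1)}=\mathbb Z_{q_n}\oplus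 \mathbb Z_{q_{n-1}}^{a-1}\oplus\mathbb Z_{q_{n-2}}^{a(a-1)}\oplus\dots\oplus\mathbb Z_{q_2}^{a^{n-3}(a-1)},$$ where for $n=2$ the sum over $k$ is empty, so that $SP(\bar T_2)\cong\mathbb Z_{q_2}$. -/

import Mathlib

namespace Sandpile

variable {α β : Type*}

/-- The multigraph obtained from `G` by adding one new edge, labelled `none`, with ends `x` and `y`.
The old edges keep their labels (as `some e`). -/
def addEdge (G : Graph α β) (x y : α) : Graph α (Option β) where
  vertexSet := G.vertexSet ∪ {x, y}
  IsLink e u v := match e with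
    | none => (u = x ∧ v = y) ∨ (u = y ∧ v = x)
    | some e => G.IsLink e u v
  isLink_symm e _ := ⟨fun u v h => by
    cases e with
    | none => simp only at h ⊢; tauto
    | some e => exact Graph.IsLink.symm h⟩
  eq_or_eq_of_isLink_of_isLink e u v u' v' h h' := by
    cases e with
    | none => simp only at h h'; grind
    | some e => exact Graph.IsLink.left_eq_or_eq h h'
  left_mem_of_isLink e u v h := by
    cases e with
    | none => simp only at h; simp; tauto
    | some e => exact Or.inl (Graph.IsLink.left_mem h)

/-- The number of edges of the multigraph `G` with ends `x` and `y`. -/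
noncomputable def edgeCount (G : Graph α β) (x y : α) : ℕ :=
  {e | G.IsLink e x y}.ncard

/-- The degree of `x` in a loopless multigraph: the number of edges incident with `x`. -/
noncomputable def degree (G : Graph α β) (x : α) : ℕ :=
  {e | G.Inc e x}.ncard

/-- The non-sink vertices of a graph with sink `s`. -/
abbrev NonSink (G : Graph α β) (s : α) : Type _ :=
  {x : α // x ∈ G.vertexSet ∧ x ≠ s}

open Classical in
/-- The reduced Laplacian of a (finite, loopless) multigraph `G` with sink `s`: the matrix indexed
by the non-sink vertices with minus the degrees on the diagonal, and with the numbers of connecting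
edges off the diagonal. -/
noncomputable def reducedLaplacian (G : Graph α β) (s : α) :
    Matrix (NonSink G s) (NonSink G s) ℤ :=
  Matrix.of fun x y => if x = y then -(degree G x.1 : ℤ) else (edgeCount G x.1 y.1 : ℤ)

/-- The lattice `Δ ℤ^V` of integer combinations of the columns of the reduced Laplacian `Δ`, where
`V` is the set of non-sink vertices. -/
noncomputable def laplacianLattice (G : Graph α β) (s : α) : Submodule ℤ (NonSink G s → ℤ) :=
  Submodule.span ℤ (Set.range (reducedLaplacian G s).col)

/-- The column lattice is the image of the reduced Laplacian. -/
theorem laplacianLattice_eq_range (G : Graph α β) (s : α) [Fintype (NonSink G s)] :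
    laplacianLattice G s = LinearMap.range (reducedLaplacian G s).mulVecLin :=
  (Matrix.range_mulVecLin _).symm

/-- The sandpile group `ℤ^V / Δ ℤ^V` of a finite loopless multigraph `G` with sink `s`. -/
abbrev SandpileGroup (G : Graph α β) (s : α) : Type _ :=
  (NonSink G s → ℤ) ⧸ laplacianLattice G s

/-- The `d`-regular tree of height `n`. Its vertices are the words of length at most `n - 1` in
`d - 1` letters; the root is the empty word, and the children of a word `w` of length less than
`n - 1` are the `d - 1` words `c :: w`. The edge joining a non-root vertex `c :: w` to its parent
`w` is labelled by `c :: w`. The leaves are the words of length exactly `n - 1`. -/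
def regularTree (d n : ℕ) : Graph (List (Fin (d - 1))) (List (Fin (d - 1))) where
  vertexSet := {w | w.length < n}
  IsLink e u v := e ≠ [] ∧ e.length < n ∧ ((u = e ∧ v = e.tail) ∨ (u = e.tail ∧ v = e))
  isLink_symm e _ := ⟨fun u v h => by tauto⟩
  eq_or_eq_of_isLink_of_isLink e u v u' v' h h' := by grind
  left_mem_of_isLink e u v h := by
    obtain ⟨-, hn, ⟨rfl, -⟩ | ⟨rfl, -⟩⟩ := h
    · exact hn
    · simp only [Set.mem_ofPred_eq, List.length_tail]; omega

/-- Sends every leaf of `regularTree d n` to the sink `none`, and fixes all other vertices. -/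
def collapseLeaves (d n : ℕ) (w : List (Fin (d - 1))) : Option (List (Fin (d - 1))) :=
  if w.length + 1 = n then none else some w

/-- The wired `d`-regular tree of height `n`: all leaves of the `d`-regular tree are identified to
a single vertex `none`, the sink (keeping multiple edges), and one more edge is added, joining the
root `some []` to the sink. -/
def wiredRegularTree (d n : ℕ) :
    Graph (Option (List (Fin (d - 1)))) (Option (List (Fin (d - 1)))) :=
  addEdge ((regularTree d n).map (collapseLeaves d n)) (some []) none

end Sandpile

/-!
Let `a = d - 1` and let `m = n - 1` be the number of levels of non-sink vertices. The sandpile group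
is generated by one element `δ w` for each word `w` of length less than `m`, subject to
`(a + 1) δ w = ∑ c, δ (c :: w) + (generator at the parent of w)`, where the generators at words of
length `m`, and the missing parent of the root, are `0`.

The isomorphism is given explicitly by functionals. For a word `u`, let the Green function of `u` be
the function on words supported on the subtree at `u` with value `q_j` at distance `j` from the
leaves. As `(a + 1) q_{j+1} = a q_j + q_{j+2}`, its Laplacian vanishes except at `u` and at the
parent of `u`, where it is a multiple of `q_{j+1}` and `q_j` respectively, `j` being the distance of
`u` from the leaves (`stencil_green`). Fix a letter `z`. The Green function of the root is therefore
harmonic modulo `q_n`, and for `c ≠ z` the difference of the Green functions of the siblings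
`c :: p` and `z :: p` is harmonic modulo `q_{j+1}`, since the terms at `p` cancel
(`dvd_stencil_greenDiff`). So each of these functions defines a homomorphism from the sandpile group
to a cyclic group, and there are `a ^ (n - 1 - k) * (a - 1)` of them with values in `ZMod q_k`.

Jointly they are bijective:
* The functional at `v` vanishes on the other generators `δ w` with `w` no longer than `v` and not
  beginning with `z`, and its value `q_j` at `δ v` is a unit modulo `q_{j+1} = a q_j + 1`. This
  triangularity gives surjectivity (`exists_dvd_sub`).
* Eliminating from the leaves upwards gives `q_{j+1} δ w = q_j δ (parent of w)`
  (`repunit_smul_sub_mem`), and the relation at `p` expresses `δ (z :: p)` through its siblings and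
  shorter words (`lowerSpan_succ_le`). If all functionals vanish on an element, then the
  coefficients of its deepest layer are divisible by `q_{j+1}`, so that the layer can be moved one
  level up; at the end nothing is left (`mem_stencilLattice_of_dvd`).
-/

open Finset Submodule

namespace Sandpile

/-! ### Repunits -/

/-- The repunit `q_k = 1 + a + ... + a ^ (k - 1)`, as an integer. -/
def repunit (a k : ℕ) : ℤ :=
  ((∑ i ∈ range k, a ^ i : ℕ) : ℤ)

@[simp]
theorem repunit_zero (a : ℕ) : repunit a 0 = 0 := by
  simp [repunit]

@[simp]
theorem repunit_one (a : ℕ) : repunit a 1 = 1 := by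
  simp [repunit]

theorem repunit_succ (a k : ℕ) : repunit a (k + 1) = a * repunit a k + 1 := by
  simp [repunit, geom_sum_succ]

theorem repunit_harmonic (a k : ℕ) :
    (a + 1) * repunit a (k + 1) = a * repunit a k + repunit a (k + 2) := by
  linear_combination repunit_succ a k - repunit_succ a (k + 1)

theorem isCoprime_repunit (a k : ℕ) : IsCoprime (repunit a (k + 1)) (repunit a k) :=
  ⟨1, -a, by rw [repunit_succ]; ring⟩

/-! ### The relations of the wired tree, and their consequences -/

section Stencil

variable {α M : Type*} [AddCommGroup M]

/-- The generator at the parent of the word `w`; it is `0` at the root, whose only neighbour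
outside its subtree is the sink. -/
def parent (δ : List α → M) : List α → M
  | [] => 0
  | _ :: w => δ w

/-- The subgroup spanned by the generators at the words of length less than `i`. -/
def lowerSpan (δ : List α → M) (i : ℕ) : Submodule ℤ M :=
  span ℤ (δ '' {w | w.length < i})

theorem mem_lowerSpan (δ : List α → M) {i : ℕ} {w : List α} (h : w.length < i) :
    δ w ∈ lowerSpan δ i :=
  subset_span ⟨w, h, rfl⟩

theorem parent_mem_lowerSpan (δ : List α → M) {w : List α} :
    parent δ w ∈ lowerSpan δ w.length := by
  cases w with
  | nil => exact zero_mem _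
  | cons c w => exact mem_lowerSpan δ (by simp)

variable [Fintype α]

/-- Degree times the generator at `w`, minus the sum of the generators at its neighbours. -/
def stencil (δ : List α → M) (w : List α) : M :=
  ((Fintype.card α : ℤ) + 1) • δ w - ∑ c, δ (c :: w) - parent δ w

/-- The subgroup spanned by the relations at the words of length less than `m`. -/
def stencilLattice (m : ℕ) (δ : List α → M) : Submodule ℤ M :=
  span ℤ (stencil δ '' {w | w.length < m})

theorem stencil_mem {m : ℕ} (δ : List α → M) {w : List α} (h : w.length < m) :
    stencil δ w ∈ stencilLattice m δ :=
  subset_span ⟨w, h, rfl⟩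

/-- In the sandpile group, `q_{j+1}` times a generator at distance `j` from the leaves is `q_j`
times the generator at its parent. This is Gaussian elimination from the leaves upwards. -/
theorem repunit_smul_sub_mem {m : ℕ} {δ : List α → M} (hδ : ∀ w, m ≤ w.length → δ w = 0)
    (j : ℕ) (w : List α) (hw : w.length + j = m) :
    repunit (Fintype.card α) (j + 1) • δ w - repunit (Fintype.card α) j • parent δ w
      ∈ stencilLattice m δ := by
  induction j generalizing w with
  | zero => simp [hδ w (by omega)]
  | succ j ih =>
    have hchild : ∑ c, (repunit (Fintype.card α) (j + 1) • δ (c :: w)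
        - repunit (Fintype.card α) j • δ w) ∈ stencilLattice m δ :=
      sum_mem fun c _ => ih (c :: w) (by simp; omega)
    have h := add_mem
      (smul_mem _ (repunit (Fintype.card α) (j + 1)) (stencil_mem δ (m := m) (w := w) (by omega)))
      hchild
    convert h using 1
    have hq : repunit (Fintype.card α) (j + 1 + 1) =
        (Fintype.card α + 1) * repunit (Fintype.card α) (j + 1)
          - Fintype.card α * repunit (Fintype.card α) j := by
      rw [repunit_harmonic]; ring
    rw [hq]
    simp only [stencil, sum_sub_distrib, sum_const, card_univ, ← smul_sum, ← natCast_zsmul]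
    module

variable [DecidableEq α]

/-- Modulo the relations, the generators at the words `z :: p` of length `i` can be eliminated. -/
theorem lowerSpan_succ_le {m i : ℕ} (hi : i ≤ m) (δ : List α → M) (z : α) :
    lowerSpan δ (i + 1) ≤ stencilLattice m δ ⊔ lowerSpan δ i
      ⊔ span ℤ (δ '' {v | v.length = i ∧ v.head? ≠ some z}) := by
  refine span_le.2 ?_
  rintro _ ⟨w, hw, rfl⟩
  have hw' : w.length < i + 1 := hw
  rcases lt_or_eq_of_le (Nat.lt_succ_iff.1 hw') with h | h
  · exact mem_sup_left (mem_sup_right (mem_lowerSpan δ h))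
  by_cases hz : w.head? = some z
  swap
  · exact mem_sup_right (subset_span ⟨w, ⟨h, hz⟩, rfl⟩)
  cases w with
  | nil => simp at hz
  | cons c p =>
    obtain rfl : c = z := by simpa using hz
    have hp : p.length + 1 = i := by simpa using h
    have key : δ (c :: p) = ((Fintype.card α : ℤ) + 1) • δ p - parent δ p - stencil δ p
        - ∑ b ∈ univ.erase c, δ (b :: p) := by
      rw [stencil, ← add_sum_erase univ (fun b => δ (b :: p)) (mem_univ c)]
      abel
    rw [SetLike.mem_coe, key]
    refine sub_mem (mem_sup_left (sub_mem (mem_sup_right (sub_mem ?_ ?_)) (mem_sup_left ?_)))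
      (mem_sup_right (sum_mem fun b hb => subset_span ⟨b :: p, ⟨by simpa using hp, ?_⟩, rfl⟩))
    · exact smul_mem _ _ (mem_lowerSpan δ (by omega))
    · refine span_mono (Set.image_mono ?_) (parent_mem_lowerSpan δ)
      intro v hv
      have hv' : v.length < p.length := hv
      exact show v.length < i by omega
    · exact stencil_mem δ (by omega)
    · simpa using ne_of_mem_erase hb

end Stencil

/-! ### The Green functionals -/

section Green

variable {α : Type*} [Fintype α] [DecidableEq α]

/-- The function on words supported on the subtree at `u` (the words ending in `u`), with value
`q_j` at distance `j` from the leaves. -/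
def green (m : ℕ) (u w : List α) : ℤ :=
  if u <:+ w then repunit (Fintype.card α) (m - w.length) else 0

/-- The function attached to a word `v`: the Green function of the whole tree if `v` is the root,
and otherwise the difference of the Green functions of the subtrees at `v = c :: p` and at its
sibling `z :: p`. -/
def greenDiff (m : ℕ) (z : α) : List α → List α → ℤ
  | [], w => green m [] w
  | c :: p, w => green m (c :: p) w - green m (z :: p) w

theorem green_eq_zero {m : ℕ} {u w : List α} (h : w.length ≤ u.length) (hne : w ≠ u) :
    green m u w = 0 :=
  if_neg fun hs => hne (hs.eq_of_length_le h).symm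

theorem green_eq_zero_of_le {m : ℕ} {u w : List α}
    (h : m ≤ w.length) : green m u w = 0 := by
  simp [green, Nat.sub_eq_zero_of_le h]

theorem green_self (m : ℕ) (u : List α) :
    green m u u = repunit (Fintype.card α) (m - u.length) :=
  if_pos List.suffix_rfl

theorem greenDiff_eq_zero {m : ℕ} {z : α} {v w : List α} (h : w.length ≤ v.length)
    (hne : w ≠ v) (hw : w.length = v.length → w.head? ≠ some z) : greenDiff m z v w = 0 := by
  cases v with
  | nil => exact green_eq_zero h hne
  | cons c p =>
    have hz : w ≠ z :: p := by
      rintro rfl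
      simp at hw
    simp [greenDiff, green_eq_zero h hne, green_eq_zero (u := z :: p) h hz]

theorem greenDiff_self {m : ℕ} {z : α} {v : List α} (hv : v.head? ≠ some z) :
    greenDiff m z v v = repunit (Fintype.card α) (m - v.length) := by
  cases v with
  | nil => exact green_self m []
  | cons c p =>
    have hc : c :: p ≠ z :: p := by simpa using hv
    simp [greenDiff, green_self, green_eq_zero (w := c :: p) (u := z :: p) (by simp) hc]

/-- The Laplacian of the Green function of a subtree is concentrated at the root `u` of the subtree
and at the parent of `u`. -/
theorem stencil_green {m : ℕ} {u w : List α} (hw : w.length < m) (hu : u.length ≤ m) :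
    stencil (green m u) w = (if w = u then repunit (Fintype.card α) (m + 1 - u.length) else 0)
      - (if u ≠ [] ∧ w = u.tail then repunit (Fintype.card α) (m - u.length) else 0) := by
  obtain ⟨j, rfl⟩ : ∃ j, m = w.length + j + 1 := ⟨m - w.length - 1, by omega⟩
  have hq := repunit_harmonic (Fintype.card α) j
  have e1 : w.length + j + 1 - w.length = j + 1 := by omega
  by_cases hs : u <:+ w
  · have hchild : ∀ c : α, green (w.length + j + 1) u (c :: w) = repunit (Fintype.card α) j := by
      intro c
      rw [green, if_pos (hs.trans (List.suffix_cons c w))]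
      congr 1
      simp only [List.length_cons]
      omega
    have htail : ¬ (u ≠ [] ∧ w = u.tail) := by
      rintro ⟨h, rfl⟩
      have := hs.length_le
      have := List.length_pos_of_ne_nil h
      simp at *
      omega
    simp only [stencil, hchild, sum_const, card_univ, nsmul_eq_mul, smul_eq_mul, if_neg htail]
    rw [green, if_pos hs, e1]
    by_cases hwu : w = u
    · subst hwu
      have hpar : parent (green (w.length + j + 1) w) w = 0 := by
        cases w with
        | nil => rfl
        | cons c w => exact green_eq_zero (by simp) (by simp)
      rw [hpar, if_pos rfl, show w.length + j + 1 + 1 - w.length = j + 2 by omega]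
      linarith
    · have hpar : parent (green (w.length + j + 1) u) w = repunit (Fintype.card α) (j + 2) := by
        cases w with
        | nil => exact absurd (List.suffix_nil.1 hs).symm hwu
        | cons c w =>
          have : u <:+ w := (List.suffix_cons_iff.1 hs).resolve_left (Ne.symm hwu)
          rw [parent, green, if_pos this]
          congr 1
          simp only [List.length_cons]
          omega
      rw [hpar, if_neg hwu]
      linarith
  · have hwu : w ≠ u := by
      rintro rfl
      exact hs List.suffix_rfl
    have hpar : parent (green (w.length + j + 1) u) w = 0 := by
      cases w with
      | nil => rfl
      | cons c w => exact if_neg fun h => hs (h.trans (List.suffix_cons c w))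
    have h0 : green (w.length + j + 1) u w = 0 := if_neg hs
    simp only [stencil, hpar, h0, if_neg hwu]
    cases u with
    | nil => exact absurd List.nil_suffix hs
    | cons b p =>
      have hchild : ∀ c : α, green (w.length + j + 1) (b :: p) (c :: w)
          = if c = b then (if w = p then
            repunit (Fintype.card α) (w.length + j + 1 - (b :: p).length) else 0) else 0 := by
        intro c
        by_cases h : c :: w = b :: p
        · obtain ⟨rfl, rfl⟩ := List.cons.inj h
          simp [green_self]
        · rw [green, if_neg]
          · symm
            split_ifs with h1 h2
            · exact absurd (by rw [h1, h2]) h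
            · rfl
            · rfl
          · intro hh
            exact (List.suffix_cons_iff.1 hh).elim (fun e => h e.symm) hs
      simp [hchild]

/-- The Green differences are harmonic modulo the repunit attached to their base word: the terms of
`stencil_green` at the common parent of the two siblings cancel. -/
theorem dvd_stencil_greenDiff {m : ℕ} {z : α} {v w : List α} (hw : w.length < m)
    (hv : v.length ≤ m) :
    repunit (Fintype.card α) (m + 1 - v.length) ∣ stencil (greenDiff m z v) w := by
  cases v with
  | nil =>
    change _ ∣ stencil (green m []) w
    rw [stencil_green hw hv]
    split_ifs <;> simp_all
  | cons c p =>
    have hsub : stencil (greenDiff m z (c :: p)) w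
        = stencil (green m (c :: p)) w - stencil (green m (z :: p)) w := by
      cases w <;> simp [stencil, parent, greenDiff, sum_sub_distrib] <;> ring
    rw [hsub, stencil_green hw hv, stencil_green hw (by simpa using hv)]
    simp only [List.length_cons, List.tail_cons, ne_eq, reduceCtorEq, not_false_eq_true, true_and]
    rw [sub_sub_sub_cancel_right]
    refine dvd_sub ?_ ?_ <;> split_ifs <;> simp

end Green

/-! ### The Green functionals determine the sandpile group -/

section Functionals

variable {α M : Type*} [Fintype α] [DecidableEq α] [AddCommGroup M] {m : ℕ} {z : α}
  {δ : List α → M} {f : List α → M →ₗ[ℤ] ℤ}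

theorem dvd_of_mem_stencilLattice (hf : ∀ v w, f v (δ w) = greenDiff m z v w) {v : List α}
    (hv : v.length ≤ m) {x : M} (hx : x ∈ stencilLattice m δ) :
    repunit (Fintype.card α) (m + 1 - v.length) ∣ f v x := by
  induction hx using span_induction with
  | mem x hx =>
    obtain ⟨w, hw, rfl⟩ := hx
    have : f v (stencil δ w) = stencil (greenDiff m z v) w := by
      cases w <;> simp [stencil, parent, hf]
    rw [this]
    exact dvd_stencil_greenDiff hw hv
  | zero => simp
  | add x y _ _ hx hy => rw [map_add]; exact dvd_add hx hy
  | smul c x _ hx => rw [map_smul]; exact hx.mul_left c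

theorem eq_zero_of_mem_lowerSpan (hf : ∀ v w, f v (δ w) = greenDiff m z v w) {v : List α}
    {x : M} (hx : x ∈ lowerSpan δ v.length) : f v x = 0 := by
  have : lowerSpan δ v.length ≤ LinearMap.ker (f v) := by
    refine span_le.2 ?_
    rintro _ ⟨w, hw, rfl⟩
    have hw' : w.length < v.length := hw
    rw [SetLike.mem_coe, LinearMap.mem_ker, hf]
    exact greenDiff_eq_zero hw'.le (by rintro rfl; simp at hw') (by omega)
  exact this hx

/-- An element on which every functional vanishes modulo its repunit is a combination of the
relations: its coefficients can be cleared layer by layer, from the deepest layer upwards. -/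
theorem mem_stencilLattice_of_dvd (hδ : ∀ w, m ≤ w.length → δ w = 0)
    (hf : ∀ v w, f v (δ w) = greenDiff m z v w) {x : M}
    (hdvd : ∀ v : List α, v.head? ≠ some z → v.length < m →
      repunit (Fintype.card α) (m + 1 - v.length) ∣ f v x) {i : ℕ} (hi : i ≤ m)
    (hx : x ∈ stencilLattice m δ ⊔ lowerSpan δ i) : x ∈ stencilLattice m δ := by
  induction i with
  | zero => simpa [lowerSpan] using hx
  | succ i ih =>
    refine ih (by omega) ?_
    have hle : stencilLattice m δ ⊔ lowerSpan δ (i + 1) ≤ stencilLattice m δ ⊔ lowerSpan δ i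
        ⊔ span ℤ (δ '' {v | v.length = i ∧ v.head? ≠ some z}) :=
      sup_le (le_sup_left.trans le_sup_left) (lowerSpan_succ_le (by omega) δ z)
    obtain ⟨y, hy, t, ht, rfl⟩ := mem_sup.1 (hle hx)
    refine add_mem hy ?_
    obtain ⟨l, hl, rfl⟩ := Finsupp.mem_span_image_iff_linearCombination ℤ |>.1 ht
    rw [Finsupp.linearCombination_apply]
    refine sum_mem fun v hv => ?_
    obtain ⟨hlen, hhead⟩ := (Finsupp.mem_supported ℤ l).1 hl hv
    subst hlen
    -- Within its layer, the functional at `v` sees only the coefficient of `v`.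
    have hfl : f v (Finsupp.linearCombination ℤ δ l)
        = l v * repunit (Fintype.card α) (m - v.length) := by
      rw [Finsupp.linearCombination_apply, Finsupp.sum, map_sum, sum_eq_single v]
      · rw [map_smul, hf, greenDiff_self hhead, smul_eq_mul]
      · intro w hw hwv
        obtain ⟨hwlen, hwhead⟩ := (Finsupp.mem_supported ℤ l).1 hl hw
        rw [map_smul, hf, greenDiff_eq_zero hwlen.le hwv fun _ => hwhead, smul_zero]
      · intro h
        rw [Finsupp.notMem_support_iff.1 h, zero_smul, map_zero]
    have hfy : repunit (Fintype.card α) (m + 1 - v.length) ∣ f v y := by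
      obtain ⟨y₁, hy₁, y₂, hy₂, rfl⟩ := mem_sup.1 hy
      rw [map_add, eq_zero_of_mem_lowerSpan hf hy₂, add_zero]
      exact dvd_of_mem_stencilLattice hf (by omega) hy₁
    have hd := hdvd v hhead (by omega)
    rw [map_add, hfl] at hd
    have hlv := (dvd_add_right hfy).1 hd
    rw [show m + 1 - v.length = m - v.length + 1 by omega] at hlv
    obtain ⟨s, hs⟩ := (isCoprime_repunit _ _).dvd_of_dvd_mul_right hlv
    have h1 := smul_mem _ s (repunit_smul_sub_mem hδ (m - v.length) v (by omega))
    have h2 := smul_mem _ (s * repunit (Fintype.card α) (m - v.length))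
      (parent_mem_lowerSpan δ (w := v))
    have h3 := add_mem (mem_sup_left h1 : _ ∈ stencilLattice m δ ⊔ lowerSpan δ v.length)
      (mem_sup_right h2)
    convert h3 using 1
    rw [hs]
    module

/-- The functionals take arbitrary values simultaneously, modulo their repunits: they are triangular
with respect to the length of words, with units on the diagonal. -/
theorem exists_dvd_sub (hf : ∀ v w, f v (δ w) = greenDiff m z v w) (t : List α → ℤ) :
    ∃ x : M, ∀ v : List α, v.head? ≠ some z → v.length < m →
      repunit (Fintype.card α) (m + 1 - v.length) ∣ f v x - t v := by
  -- The layers are treated from the deepest one upwards.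
  suffices h : ∀ j ≤ m, ∃ x : M, ∀ v : List α, v.head? ≠ some z → v.length < m →
      m ≤ v.length + j → repunit (Fintype.card α) (m + 1 - v.length) ∣ f v x - t v by
    obtain ⟨x, hx⟩ := h m le_rfl
    exact ⟨x, fun v h1 h2 => hx v h1 h2 (by omega)⟩
  intro j
  induction j with
  | zero => exact fun _ => ⟨0, fun v _ h1 h2 => by omega⟩
  | succ j ih =>
    intro hj
    obtain ⟨x, hx⟩ := ih (by omega)
    obtain ⟨r, s, hrs⟩ := isCoprime_repunit (Fintype.card α) (j + 1)
    let S : Finset (List α) :=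
      (List.finite_length_eq α (m - (j + 1))).toFinset.filter fun v => v.head? ≠ some z
    have hS : ∀ w ∈ S, w.length = m - (j + 1) ∧ w.head? ≠ some z := by
      simp [S]
    refine ⟨x + ∑ w ∈ S, (s * (t w - f w x)) • δ w, fun v hv hvm hvj => ?_⟩
    rw [map_add, map_sum]
    rcases Nat.lt_or_ge (v.length + j) m with hlt | hge
    · have hlen : v.length = m - (j + 1) := by omega
      rw [sum_eq_single v]
      · rw [map_smul, hf, greenDiff_self hv, show m + 1 - v.length = j + 1 + 1 by omega,
          show m - v.length = j + 1 by omega, smul_eq_mul]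
        exact ⟨r * (f v x - t v), by linear_combination (-(f v x - t v)) * hrs⟩
      · intro w hw hwv
        obtain ⟨h1, h2⟩ := hS w hw
        rw [map_smul, hf, greenDiff_eq_zero (by omega) hwv fun _ => h2, smul_zero]
      · intro h
        simp [S, hlen] at h
        exact absurd h hv
    · rw [sum_eq_zero, add_zero]
      · exact hx v hv hvm hge
      · intro w hw
        obtain ⟨h1, h2⟩ := hS w hw
        rw [map_smul, hf, greenDiff_eq_zero (by omega) (by rintro rfl; omega) fun _ => h2,
          smul_zero]

end Functionals

/-! ### The wired regular tree -/

section Graph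

variable {d n : ℕ}

theorem length_lt_of_tail_eq {α : Type*} {u w : List α} (h : u ≠ [] ∧ u.tail = w) :
    w.length < u.length := by
  rw [← h.2, List.length_tail]
  exact Nat.sub_lt (List.length_pos_of_ne_nil h.1) one_pos

/-- The edges of the tree with collapsed leaves at a non-leaf vertex `u`: the edge `u` towards the
parent, and the edges named by the children of `u`. -/
theorem isLink_regularTree_map_iff {e u : List (Fin (d - 1))}
    (hu : u.length + 1 < n) {y : Option (List (Fin (d - 1)))} :
    ((regularTree d n).map (collapseLeaves d n)).IsLink e (some u) y ↔
      e ≠ [] ∧ e.length < n ∧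
        ((e = u ∧ y = some u.tail) ∨ (e.tail = u ∧ y = collapseLeaves d n e)) := by
  have hfix : ∀ w : List (Fin (d - 1)), w.length + 1 < n → collapseLeaves d n w = some w :=
    fun w hw => if_neg (by omega)
  have hsome : ∀ w : List (Fin (d - 1)), some u = collapseLeaves d n w → w = u := by
    intro w hw
    unfold collapseLeaves at hw
    split_ifs at hw
    exact (Option.some.inj hw).symm
  have htail : u.tail.length + 1 < n := by
    rw [List.length_tail]
    omega
  constructor
  · rintro ⟨u', v', ⟨he, hen, ⟨rfl, rfl⟩ | ⟨rfl, rfl⟩⟩, h1, h2⟩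
    · obtain rfl := hsome _ h1.symm
      exact ⟨he, hen, .inl ⟨rfl, by rw [← h2, hfix _ htail]⟩⟩
    · exact ⟨he, hen, .inr ⟨hsome _ h1.symm, h2.symm⟩⟩
  · rintro ⟨he, hen, ⟨rfl, rfl⟩ | ⟨rfl, rfl⟩⟩
    · exact ⟨_, _, ⟨he, hen, .inl ⟨rfl, rfl⟩⟩, hfix _ hu, hfix _ htail⟩
    · exact ⟨_, _, ⟨he, hen, .inr ⟨rfl, rfl⟩⟩, hfix _ hu, rfl⟩

theorem degree_wiredRegularTree (hd : 1 ≤ d) {u : List (Fin (d - 1))}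
    (hu : u.length + 1 < n) : degree (wiredRegularTree d n) (some u) = d := by
  -- The edge towards the parent, which at the root is the extra edge to the sink.
  let up : Option (List (Fin (d - 1))) := if u = [] then none else some u
  have hset : {e | (wiredRegularTree d n).Inc e (some u)}
      = insert up (Set.range fun c => some (c :: u)) := by
    ext e
    rw [Set.mem_insert_iff, Set.mem_range]
    cases e with
    | none =>
      have : (wiredRegularTree d n).Inc none (some u) ↔ u = [] := by
        constructor
        · rintro ⟨y, ⟨h, -⟩ | ⟨h, -⟩⟩
          · exact Option.some.inj h
          · cases h
        · rintro rfl
          exact ⟨none, .inl ⟨rfl, rfl⟩⟩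
      refine this.trans ?_
      by_cases h : u = [] <;> simp [up, h]
    | some e =>
      have h1 : (wiredRegularTree d n).Inc (some e) (some u) ↔
          ∃ y, e ≠ [] ∧ e.length < n ∧
            ((e = u ∧ y = some u.tail) ∨ (e.tail = u ∧ y = collapseLeaves d n e)) :=
        exists_congr fun y => isLink_regularTree_map_iff hu
      refine h1.trans ?_
      constructor
      · rintro ⟨y, he, hen, ⟨rfl, -⟩ | ⟨rfl, -⟩⟩
        · exact .inl (by simp [up, he])
        · obtain ⟨c, p, rfl⟩ := List.exists_cons_of_ne_nil he
          exact .inr ⟨c, rfl⟩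
      · rintro (h | ⟨c, h⟩)
        · have hu0 : u ≠ [] := by
            rintro rfl
            simp [up] at h
          obtain rfl : e = u := by simpa [up, hu0] using h
          exact ⟨_, hu0, by omega, .inl ⟨rfl, rfl⟩⟩
        · obtain rfl := Option.some.inj h
          exact ⟨_, by simp, by simpa using hu, .inr ⟨rfl, rfl⟩⟩
  have hup : up ∉ Set.range fun c => some (c :: u) := by
    rintro ⟨c, hc⟩
    by_cases h : u = [] <;> simp [up, h] at hc
  have hinj : Function.Injective fun c : Fin (d - 1) => some (c :: u) := by
    intro b c h
    simpa using h
  rw [degree, hset, Set.ncard_insert_of_notMem hup (Set.finite_range _),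
    Set.ncard_range_of_injective hinj, Nat.card_eq_fintype_card, Fintype.card_fin]
  omega

theorem edgeCount_wiredRegularTree {u w : List (Fin (d - 1))}
    (hu : u.length + 1 < n) (hw : w.length + 1 < n) (hne : u ≠ w) :
    edgeCount (wiredRegularTree d n) (some u) (some w)
      = if (u ≠ [] ∧ u.tail = w) ∨ (w ≠ [] ∧ w.tail = u) then 1 else 0 := by
  have hlink : ∀ e, (wiredRegularTree d n).IsLink e (some u) (some w) ↔
      (e = some u ∧ u ≠ [] ∧ u.tail = w) ∨ (e = some w ∧ w ≠ [] ∧ w.tail = u) := by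
    intro e
    cases e with
    | none =>
      simp only [reduceCtorEq, false_and, or_false, iff_false]
      rintro (⟨-, h⟩ | ⟨h, -⟩) <;> cases h
    | some e =>
      refine (isLink_regularTree_map_iff hu).trans ?_
      constructor
      · rintro ⟨he, hen, ⟨rfl, h⟩ | ⟨rfl, h⟩⟩
        · exact .inl ⟨rfl, he, (Option.some.inj h).symm⟩
        · unfold collapseLeaves at h
          split_ifs at h
          obtain rfl := Option.some.inj h
          exact .inr ⟨rfl, he, rfl⟩
      · rintro (⟨h, h0, rfl⟩ | ⟨h, h0, rfl⟩)
        · obtain rfl := Option.some.inj h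
          exact ⟨h0, by omega, .inl ⟨rfl, rfl⟩⟩
        · obtain rfl := Option.some.inj h
          exact ⟨h0, by omega, .inr ⟨rfl, (if_neg (by omega)).symm⟩⟩
  simp only [edgeCount, hlink]
  split_ifs with h
  · rw [Set.ncard_eq_one]
    rcases h with h | h
    · have h' : ¬ (w ≠ [] ∧ w.tail = u) :=
        fun hwu => (length_lt_of_tail_eq h).not_gt (length_lt_of_tail_eq hwu)
      exact ⟨some u, by ext e; simp [h, h']⟩
    · have h' : ¬ (u ≠ [] ∧ u.tail = w) :=
        fun hwu => (length_lt_of_tail_eq h).not_gt (length_lt_of_tail_eq hwu)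
      exact ⟨some w, by ext e; simp [h, h']⟩
  · rw [not_or] at h
    simp [h]

theorem mem_vertexSet_wiredRegularTree_iff (hn : 2 ≤ n) {u : List (Fin (d - 1))} :
    some u ∈ (wiredRegularTree d n).vertexSet ↔ u.length < n - 1 := by
  have h0 : some u ∈ (wiredRegularTree d n).vertexSet ↔
      some u ∈ collapseLeaves d n '' {w | w.length < n} ∨ u = [] := by
    refine or_congr Iff.rfl ?_
    simp
  rw [h0]
  constructor
  · rintro (⟨w, hw, h⟩ | rfl)
    · have hw' : w.length < n := hw
      unfold collapseLeaves at h
      split_ifs at h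
      obtain rfl := Option.some.inj h
      omega
    · rw [List.length_nil]
      omega
  · intro h
    exact .inl ⟨u, show u.length < n by omega, if_neg (by omega)⟩

/-- The non-sink vertices are the words of length less than `n - 1`. -/
noncomputable def nonSinkEquiv (d : ℕ) (hn : 2 ≤ n) :
    NonSink (wiredRegularTree d n) none ≃ {w : List (Fin (d - 1)) // w.length < n - 1} where
  toFun x := ⟨x.1.get (Option.isSome_iff_ne_none.2 x.2.2),
    (mem_vertexSet_wiredRegularTree_iff hn).1 (by simpa using x.2.1)⟩
  invFun w := ⟨some w.1, (mem_vertexSet_wiredRegularTree_iff hn).2 w.2, by simp⟩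
  left_inv x := by simp
  right_inv w := by simp

/-- The indicator function of the word `w` among the non-sink vertices; it is `0` if `w` is not the
name of a non-sink vertex. -/
def vertexIndicator (d n : ℕ) (w : List (Fin (d - 1))) :
    NonSink (wiredRegularTree d n) none → ℤ :=
  fun x => if x.1 = some w then 1 else 0

theorem vertexIndicator_eq_zero (hn : 2 ≤ n) {w : List (Fin (d - 1))} (hw : n - 1 ≤ w.length) :
    vertexIndicator d n w = 0 := by
  funext x
  refine if_neg fun h => ?_
  have := (mem_vertexSet_wiredRegularTree_iff hn).1 (h ▸ x.2.1)
  omega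

/-- The columns of the reduced Laplacian are the negatives of the stencils: the words which do not
name a non-sink vertex contribute nothing, like the edges to the sink. -/
theorem reducedLaplacian_col (hd : 1 ≤ d) (hn : 2 ≤ n)
    (y : NonSink (wiredRegularTree d n) none) :
    (reducedLaplacian (wiredRegularTree d n) none).col y
      = -stencil (vertexIndicator d n) (nonSinkEquiv d hn y).1 := by
  obtain ⟨⟨w, hw⟩, rfl⟩ := (nonSinkEquiv d hn).symm.surjective y
  funext x
  obtain ⟨⟨u, hu⟩, rfl⟩ := (nonSinkEquiv d hn).symm.surjective x
  have hx : ∀ v, vertexIndicator d n v ((nonSinkEquiv d hn).symm ⟨u, hu⟩)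
      = if u = v then 1 else 0 := by
    intro v
    simp [vertexIndicator, nonSinkEquiv]
  have hsum : ∑ c, (if u = c :: w then (1 : ℤ) else 0) = if u ≠ [] ∧ u.tail = w then 1 else 0 := by
    cases u with
    | nil => simp
    | cons b p =>
      by_cases h : p = w <;> simp [h]
  have hpar : parent (vertexIndicator d n) w ((nonSinkEquiv d hn).symm ⟨u, hu⟩)
      = if w ≠ [] ∧ w.tail = u then 1 else 0 := by
    cases w with
    | nil => simp [parent]
    | cons c p => simp [parent, hx, eq_comm]
  rw [Equiv.apply_symm_apply]
  simp only [Pi.neg_apply, stencil, Pi.sub_apply, Pi.smul_apply, Finset.sum_apply, hx, hsum, hpar,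
    Fintype.card_fin, smul_eq_mul]
  have hlt : ((d - 1 : ℕ) : ℤ) = d - 1 := by omega
  by_cases h : u = w
  · subst h
    have h1 : ¬ (u ≠ [] ∧ u.tail = u) := fun h => (length_lt_of_tail_eq h).false
    have hdeg := degree_wiredRegularTree (n := n) hd (u := u) (by omega)
    simp only [Matrix.col_apply, reducedLaplacian, Matrix.of_apply, if_true, if_neg h1]
    change -(degree (wiredRegularTree d n) (some u) : ℤ) = _
    rw [hdeg, hlt]
    ring
  · have hec := edgeCount_wiredRegularTree (n := n) (u := u) (w := w) (by omega) (by omega) h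
    have hne : (nonSinkEquiv d hn).symm ⟨u, hu⟩ ≠ (nonSinkEquiv d hn).symm ⟨w, hw⟩ := by
      simpa using h
    simp only [Matrix.col_apply, reducedLaplacian, Matrix.of_apply, if_neg hne, if_neg h]
    change (edgeCount (wiredRegularTree d n) (some u) (some w) : ℤ) = _
    rw [hec]
    have hex : ¬ ((u ≠ [] ∧ u.tail = w) ∧ (w ≠ [] ∧ w.tail = u)) := fun h =>
      (length_lt_of_tail_eq h.1).not_gt (length_lt_of_tail_eq h.2)
    by_cases hA : u ≠ [] ∧ u.tail = w <;> by_cases hB : w ≠ [] ∧ w.tail = u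
    · exact absurd ⟨hA, hB⟩ hex
    all_goals norm_num [hA, hB]

theorem laplacianLattice_eq_stencilLattice (hd : 1 ≤ d) (hn : 2 ≤ n) :
    laplacianLattice (wiredRegularTree d n) none
      = stencilLattice (n - 1) (vertexIndicator d n) := by
  refine le_antisymm (span_le.2 ?_) (span_le.2 ?_)
  · rintro _ ⟨y, rfl⟩
    rw [SetLike.mem_coe, reducedLaplacian_col hd hn]
    exact neg_mem (stencil_mem _ (nonSinkEquiv d hn y).2)
  · rintro _ ⟨w, hw, rfl⟩
    have h := subset_span (R := ℤ) (Set.mem_range_self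
      (f := (reducedLaplacian (wiredRegularTree d n) none).col)
      ((nonSinkEquiv d hn).symm ⟨w, hw⟩))
    rw [SetLike.mem_coe, reducedLaplacian_col hd hn, Equiv.apply_symm_apply, neg_mem_iff] at h
    exact h

noncomputable instance : Fintype {w : List (Fin (d - 1)) // w.length < n} :=
  (List.finite_length_lt _ n).fintype

theorem lowerSpan_vertexIndicator (d : ℕ) (hn : 2 ≤ n) :
    lowerSpan (vertexIndicator d n) (n - 1) = ⊤ := by
  refine eq_top_iff.2 fun x _ => ?_
  have : x = ∑ w : {w : List (Fin (d - 1)) // w.length < n - 1},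
      x ((nonSinkEquiv d hn).symm w) • vertexIndicator d n w.1 := by
    funext y
    obtain ⟨w, rfl⟩ := (nonSinkEquiv d hn).symm.surjective y
    simp [vertexIndicator, nonSinkEquiv, Subtype.coe_inj]
  rw [this]
  exact sum_mem fun w _ => smul_mem _ _ (mem_lowerSpan _ w.2)

/-- The linear extension of the Green difference at `v` to functions on the non-sink vertices. -/
noncomputable def greenFunctional (hn : 2 ≤ n) (z : Fin (d - 1)) (v : List (Fin (d - 1))) :
    (NonSink (wiredRegularTree d n) none → ℤ) →ₗ[ℤ] ℤ :=
  ∑ w : {w : List (Fin (d - 1)) // w.length < n - 1},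
    greenDiff (n - 1) z v w.1 • LinearMap.proj ((nonSinkEquiv d hn).symm w)

theorem greenFunctional_vertexIndicator (hn : 2 ≤ n) (z : Fin (d - 1))
    (v w : List (Fin (d - 1))) :
    greenFunctional hn z v (vertexIndicator d n w) = greenDiff (n - 1) z v w := by
  rcases Nat.lt_or_ge w.length (n - 1) with h | h
  · rw [greenFunctional, LinearMap.sum_apply, sum_eq_single ⟨w, h⟩]
    · simp [vertexIndicator, nonSinkEquiv]
    · rintro ⟨u, hu⟩ - hne
      have : u ≠ w := by simpa using hne
      simp [vertexIndicator, nonSinkEquiv, this]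
    · simp
  · rw [vertexIndicator_eq_zero hn h, map_zero]
    cases v <;> simp [greenDiff, green_eq_zero_of_le h]

end Graph

/-! ### The decomposition -/

/-- The words of length `l + 1` whose first letter is not `z` are counted by their tails and their
first letters. -/
theorem card_words_head_ne {α : Type*} [Fintype α] (z : α) (l : ℕ) :
    Nat.card {v : List α // v.length = l + 1 ∧ v.head? ≠ some z}
      = Fintype.card α ^ l * (Fintype.card α - 1) := by
  classical
  let e : {v : List α // v.length = l + 1 ∧ v.head? ≠ some z} ≃ List.Vector α l × {c // c ≠ z} :=
    { toFun := fun v =>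
        ⟨⟨v.1.tail, by simp [v.2.1]⟩,
          ⟨v.1.head (List.ne_nil_of_length_eq_add_one v.2.1), fun h => v.2.2 (by
            rw [List.head?_eq_some_head (List.ne_nil_of_length_eq_add_one v.2.1), h])⟩⟩
      invFun := fun p => ⟨p.2.1 :: p.1.1, by simp [p.1.2], by simpa using p.2.2⟩
      left_inv := fun v => by simp
      right_inv := fun ⟨⟨p, hp⟩, c⟩ => by simp }
  rw [Nat.card_congr e, Nat.card_eq_fintype_card, Fintype.card_prod, card_vector,
    Fintype.card_subtype_compl, Fintype.card_subtype_eq]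

end Sandpile

open Sandpile in
theorem theorem1p2 (d a n : ℕ) (hd : 3 ≤ d) (hda : d = a + 1) (hn : 2 ≤ n) :
    Nonempty
      (Sandpile.SandpileGroup (Sandpile.wiredRegularTree d n) none ≃+
        ZMod (∑ i ∈ Finset.range n, a ^ i) ×
          ((k : Finset.Ico 2 n) → Fin (a ^ (n - 1 - (k : ℕ)) * (a - 1)) →
            ZMod (∑ i ∈ Finset.range (k : ℕ), a ^ i))) := by
  have hcard : Fintype.card (Fin (d - 1)) = a := by simp [hda]
  let z : Fin (d - 1) := ⟨0, by omega⟩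
  have hword : ∀ k : Finset.Ico 2 n, Nonempty (Fin (a ^ (n - 1 - (k : ℕ)) * (a - 1)) ≃
      {v : List (Fin (d - 1)) // v.length = n - 1 - (k : ℕ) + 1 ∧ v.head? ≠ some z}) := by
    intro k
    have : Finite {v : List (Fin (d - 1)) // v.length = n - 1 - (k : ℕ) + 1 ∧ v.head? ≠ some z} :=
      (List.finite_length_eq _ (n - 1 - (k : ℕ) + 1)).subset fun v hv => hv.1
    refine ⟨(Finite.equivFinOfCardEq ?_).symm⟩
    rw [card_words_head_ne, hcard]
  obtain ⟨e⟩ := Classical.nonempty_pi.2 hword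
  have hf := greenFunctional_vertexIndicator hn z
  let F : (NonSink (wiredRegularTree d n) none → ℤ) →ₗ[ℤ]
      ZMod (∑ i ∈ Finset.range n, a ^ i) ×
        ((k : Finset.Ico 2 n) → Fin (a ^ (n - 1 - (k : ℕ)) * (a - 1)) →
          ZMod (∑ i ∈ Finset.range (k : ℕ), a ^ i)) :=
    AddMonoidHom.toIntLinearMap
      { toFun := fun x => (((greenFunctional hn z [] x : ℤ) : ZMod _),
          fun k i => ((greenFunctional hn z (e k i).1 x : ℤ) : ZMod _))
        map_zero' := by ext <;> simp
        map_add' := fun x y => by ext <;> simp }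
  -- The index set of the target consists of the root and the words that do not begin with `z`.
  have hindex : ∀ P : List (Fin (d - 1)) → ℕ → Prop,
      (P [] n ∧ ∀ (k : Finset.Ico 2 n) i, P (e k i).1 k) ↔
        ∀ v : List (Fin (d - 1)), v.head? ≠ some z → v.length < n - 1 →
          P v (n - 1 + 1 - v.length) := by
    intro P
    constructor
    · rintro ⟨h0, h1⟩ v hv hlen
      rcases Nat.eq_zero_or_pos v.length with h | h
      · obtain rfl := List.length_eq_zero_iff.1 h
        simpa [Nat.sub_add_cancel (by omega : 1 ≤ n)] using h0
      · have hk : n - 1 + 1 - v.length ∈ Finset.Ico 2 n := by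
          rw [Finset.mem_Ico]
          omega
        have := h1 ⟨_, hk⟩ ((e ⟨_, hk⟩).symm ⟨v, by simp only; omega, hv⟩)
        rwa [Equiv.apply_symm_apply] at this
    · intro h
      refine ⟨by simpa [Nat.sub_add_cancel (by omega : 1 ≤ n)] using h [] (by simp) (by simp; omega),
        fun k i => ?_⟩
      obtain ⟨hlen, hhead⟩ := (e k i).2
      have hk := Finset.mem_Ico.1 k.2
      have := h _ hhead (by omega)
      rwa [hlen, show n - 1 + 1 - (n - 1 - (k : ℕ) + 1) = k by omega] at this
  have hker : LinearMap.ker F = laplacianLattice (wiredRegularTree d n) none := by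
    rw [laplacianLattice_eq_stencilLattice (by omega) hn]
    ext x
    have h1 : x ∈ LinearMap.ker F ↔ ∀ v : List (Fin (d - 1)), v.head? ≠ some z →
        v.length < n - 1 → repunit a (n - 1 + 1 - v.length) ∣ greenFunctional hn z v x := by
      rw [← hindex fun v k => repunit a k ∣ greenFunctional hn z v x, LinearMap.mem_ker,
        Prod.ext_iff, funext_iff]
      refine and_congr (ZMod.intCast_zmod_eq_zero_iff_dvd _ _) (forall_congr' fun k => ?_)
      exact funext_iff.trans (forall_congr' fun i => ZMod.intCast_zmod_eq_zero_iff_dvd _ _)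
    rw [h1, ← hcard]
    constructor
    · intro h
      refine mem_stencilLattice_of_dvd (fun w hw => vertexIndicator_eq_zero hn hw) hf h le_rfl ?_
      rw [lowerSpan_vertexIndicator d hn]
      exact Submodule.mem_sup_right trivial
    · exact fun h v _ hv => dvd_of_mem_stencilLattice hf hv.le h
  have hsurj : Function.Surjective F := by
    rintro ⟨t₀, t₁⟩
    classical
    -- Integer representatives of the prescribed residues, indexed by words.
    let t : List (Fin (d - 1)) → ℤ := fun v =>
      if h : ∃ k i, (e k i).1 = v then (t₁ h.choose h.choose_spec.choose).cast else t₀.cast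
    have ht₀ : t [] = t₀.cast := by
      refine dif_neg ?_
      rintro ⟨k, i, h⟩
      have := (e k i).2.1
      simp [h] at this
    have ht₁ : ∀ k i, t (e k i).1 = (t₁ k i).cast := by
      intro k i
      have h : ∃ k' i', (e k' i').1 = (e k i).1 := ⟨k, i, rfl⟩
      have hk : h.choose = k := by
        have h1 := (e _ h.choose_spec.choose).2.1
        rw [h.choose_spec.choose_spec, (e k i).2.1] at h1
        have h2 := Finset.mem_Ico.1 h.choose.2
        have h3 := Finset.mem_Ico.1 k.2
        exact Subtype.ext (by omega)
      have key : ∀ k' i', k' = k → (e k' i').1 = (e k i).1 →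
          (t₁ k' i').cast = ((t₁ k i).cast : ℤ) := by
        rintro k' i' rfl h'
        rw [(e k').injective (Subtype.ext h')]
      rw [show t (e k i).1 = _ from dif_pos h]
      exact key _ _ hk h.choose_spec.choose_spec
    obtain ⟨x, hx⟩ := exists_dvd_sub hf t
    rw [hcard] at hx
    obtain ⟨h0, h1⟩ := (hindex fun v k => repunit a k ∣ greenFunctional hn z v x - t v).2 hx
    refine ⟨x, Prod.ext ?_ (funext fun k => funext fun i => ?_)⟩
    · have := (ZMod.intCast_eq_intCast_iff_dvd_sub _ _ _).2 h0
      rw [ht₀, ZMod.intCast_zmod_cast] at this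
      exact this.symm
    · have := (ZMod.intCast_eq_intCast_iff_dvd_sub _ _ _).2 (h1 k i)
      rw [ht₁, ZMod.intCast_zmod_cast] at this
      exact this.symm
  exact ⟨((Submodule.quotEquivOfEq _ _ hker.symm).trans
    (F.quotKerEquivOfSurjective hsurj)).toAddEquiv⟩
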